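/- Let $n\ge 2$ and $a,N>0$. Equip $\mathbb{R}^{2n}$ with coordinates $(x_i,y_i)_{i=1,\dots,n}$, the standard symplectic form $\omega_{\mathrm{st}}=\sum_i dx_i\wedge dy_i$ and the standard complex structure $J_{\mathrm{st}}$ ($\partial_{x_i}\mapsto\partial_{y_i}$, $\partial_{y_i}\mapsto-\partial_{x_i}$), and let $B_R=\{\sum_i x_i^2+y_i^2\le R^2\}\subset\mathbb{R}^{2n}$ be the closed ball of radius $R$. Let $\omega_{\mathbb{CP}^1}$ be the Fubini–Study form on $\mathbb{CP}^1$ of total area $\pi a^2$, i.e. $\omega_{\mathbb{CP}^1}=a^2(1+|z|^2)^{-2}\,dx\wedge dy$ in either affine coordinate $z=x+iy$ (equivalently, the form that extends $dx\wedge dy$ on the open disk of radius $a$ under $w\mapsto[w:\sqrt{a^2-|w|^2}]$). Let $T=\mathbb{R}^{2n-2}/N\mathbb{Z}^{2n-2}$ carry the symplectic form $\omega_T$ induced from $\omega_{\mathrm{st}}$, and let $\omega=\omega_{\mathbb{CP}^1}\oplus\omega_T$ on $\mathbb{CP}^1\times T$. **Lemma 2.1.** Let $0<R'<R$ and let $\varphi:(B_R,\omega_{\mathrm{st}})\hookrightarrow(\mathbb{CP}^1\times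 T,\omega)$ be a symplectic embedding, that is, a smooth embedding (smooth up to the boundary of $B_R$) with $\varphi^*\omega=\omega_{\mathrm{st}}$. Then there is a smooth almost complex structure $J_1$ on $\mathbb{CP}^1\times T$ that is compatible with $\omega$ (i.e. $\omega(\cdot,J_1\cdot)$ is a Riemannian metric) and satisfies $\varphi^*J_1|_{B_{R'}}=J_{\mathrm{st}}$, i.e. $J_1(\varphi(x))\circ d\varphi_x=d\varphi_x\circ J_{\mathrm{st}}$ for all $x\in B_{R'}$. -/

import Mathlib

open scoped Manifold ContDiff Topology
open LinearAlgebra.Projectivization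

noncomputable section

/-! ### Linear symplectic space `ℝ²ⁿ` -/

/-- `ℝ²ⁿ` with its Euclidean norm. The coordinates of a vector `v` are `xᵢ = v (i, 0)` and
`yᵢ = v (i, 1)`. -/
abbrev R2 (n : ℕ) : Type := EuclideanSpace ℝ (Fin n × Fin 2)

/-- The standard symplectic form `∑ dxᵢ ∧ dyᵢ` on `ℝ²ⁿ`. -/
def omegaSt (n : ℕ) : R2 n →L[ℝ] R2 n →L[ℝ] ℝ :=
  ∑ i : Fin n,
    ((EuclideanSpace.proj (i, 0) : R2 n →L[ℝ] ℝ).smulRight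
        (EuclideanSpace.proj (i, 1) : R2 n →L[ℝ] ℝ) -
      (EuclideanSpace.proj (i, 1) : R2 n →L[ℝ] ℝ).smulRight
        (EuclideanSpace.proj (i, 0) : R2 n →L[ℝ] ℝ))

/-- The standard complex structure on `ℝ²ⁿ`: `∂/∂xᵢ ↦ ∂/∂yᵢ`, `∂/∂yᵢ ↦ -∂/∂xᵢ`. -/
def JSt (n : ℕ) : R2 n →L[ℝ] R2 n :=
  LinearMap.toContinuousLinearMap
    { toFun := fun v => WithLp.toLp 2 fun p => if p.2 = 0 then -v (p.1, 1) else v (p.1, 0)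
      map_add' := by
        intro u v
        ext p
        by_cases h : p.2 = 0 <;> simp [h, add_comm]
      map_smul' := by
        intro c v
        ext p
        by_cases h : p.2 = 0 <;> simp [h] }

/-! ### Bilinear forms and almost complex structures on manifolds -/

section Manifolds

variable {E : Type*} [NormedAddCommGroup E] [NormedSpace ℝ E]
  {H : Type*} [TopologicalSpace H]
  {E' : Type*} [NormedAddCommGroup E'] [NormedSpace ℝ E']
  {H' : Type*} [TopologicalSpace H']

/-- A field of bilinear forms on the tangent spaces of `M`. -/
abbrev FormField (I : ModelWithCorners ℝ E H) (M : Type*) [TopologicalSpace M]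
    [ChartedSpace H M] : Type _ :=
  ∀ x : M, TangentSpace I x →L[ℝ] TangentSpace I x →L[ℝ] ℝ

/-- The pullback `(f^*σ)_x (u, v) = σ_{f x} (df_x u, df_x v)`. -/
def FormField.pullback (I : ModelWithCorners ℝ E H) (I' : ModelWithCorners ℝ E' H')
    {M : Type*} [TopologicalSpace M] [ChartedSpace H M]
    {M' : Type*} [TopologicalSpace M'] [ChartedSpace H' M']
    (f : M → M') (σ : FormField I' M') : FormField I M :=
  fun x => (ContinuousLinearMap.precomp ℝ (mfderiv I I' f x)).comp
    ((σ (f x)).comp (mfderiv I I' f x))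

theorem FormField.pullback_apply (I : ModelWithCorners ℝ E H) (I' : ModelWithCorners ℝ E' H')
    {M : Type*} [TopologicalSpace M] [ChartedSpace H M]
    {M' : Type*} [TopologicalSpace M'] [ChartedSpace H' M']
    (f : M → M') (σ : FormField I' M') (x : M) (u v : TangentSpace I x) :
    FormField.pullback I I' f σ x u v = σ (f x) (mfderiv I I' f x u) (mfderiv I I' f x v) :=
  rfl

/-- The form `σ₁ ⊕ σ₂ = pr₁^*σ₁ + pr₂^*σ₂` on a product. -/
def FormField.prod {I : ModelWithCorners ℝ E H} {I' : ModelWithCorners ℝ E' H'}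
    {M : Type*} [TopologicalSpace M] [ChartedSpace H M]
    {M' : Type*} [TopologicalSpace M'] [ChartedSpace H' M']
    (σ₁ : FormField I M) (σ₂ : FormField I' M') : FormField (I.prod I') (M × M') :=
  fun x => FormField.pullback (I.prod I') I Prod.fst σ₁ x +
    FormField.pullback (I.prod I') I' Prod.snd σ₂ x

/-- A (smooth) almost complex structure on `M`: a smooth section `J` of the endomorphism bundle
of `TM` with `J² = -1`. -/
structure AlmostComplexStructure (I : ModelWithCorners ℝ E H) (M : Type*) [TopologicalSpace M]
    [ChartedSpace H M] [IsManifold I ∞ M] where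
  /-- The endomorphism of each tangent space. -/
  toFun : ∀ x : M, TangentSpace I x →L[ℝ] TangentSpace I x
  contMDiff : ContMDiff I (I.prod 𝓘(ℝ, E →L[ℝ] E)) ∞
    (fun x => Bundle.TotalSpace.mk' (E →L[ℝ] E)
      (E := fun x : M => TangentSpace I x →L[ℝ] TangentSpace I x) x (toFun x))
  sq_eq_neg : ∀ (x : M) (v : TangentSpace I x), toFun x (toFun x v) = -v

/-- `J` is compatible with `σ` if `σ(·, J ·)` is a Riemannian metric, that is, symmetric and
positive definite on every tangent space (it is smooth as soon as `σ` and `J` are). -/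
structure AlmostComplexStructure.IsCompatible {I : ModelWithCorners ℝ E H} {M : Type*}
    [TopologicalSpace M] [ChartedSpace H M] [IsManifold I ∞ M]
    (J : AlmostComplexStructure I M) (σ : FormField I M) : Prop where
  symm : ∀ (x : M) (u v : TangentSpace I x), σ x u (J.toFun x v) = σ x v (J.toFun x u)
  pos : ∀ (x : M) (v : TangentSpace I x), v ≠ 0 → 0 < σ x v (J.toFun x v)

/-- `φ` restricts to a symplectic embedding of the subset `s` of `(ℝ²ⁿ, ω_st)` into `(M, σ)`:
it is smooth on `s` (up to the boundary), a homeomorphism of `s` onto its image, and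
`φ^*σ = ω_st` on `s`. It is automatically an immersion, because `ω_st` is nondegenerate.
The values of `φ` outside `s` are irrelevant. -/
structure IsSymplecticEmbeddingOn {n : ℕ} (I : ModelWithCorners ℝ E H) {M : Type*}
    [TopologicalSpace M] [ChartedSpace H M]
    (φ : R2 n → M) (s : Set (R2 n)) (σ : FormField I M) : Prop where
  contMDiffOn : ContMDiffOn 𝓘(ℝ, R2 n) I ∞ φ s
  isEmbedding : Topology.IsEmbedding (s.domRestrict φ)
  pullback_eq : ∀ x ∈ s, ∀ u v : R2 n,
    σ (φ x) (mfderivWithin 𝓘(ℝ, R2 n) I φ s x u) (mfderivWithin 𝓘(ℝ, R2 n) I φ s x v) =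
      omegaSt n u v

end Manifolds

/-! ### The complex projective line -/

/-- `ℂP¹`, the space of complex lines in `ℂ²`. -/
def CP1 : Type := ℙ ℂ (Fin 2 → ℂ)

namespace CP1

/-- The point `[v₀ : v₁]`. -/
def mk (v : {v : Fin 2 → ℂ // v ≠ 0}) : CP1 := Projectivization.mk' ℂ v

/-- The quotient topology. -/
instance : TopologicalSpace CP1 := TopologicalSpace.coinduced mk inferInstance

theorem mk_surjective : Function.Surjective mk := Quotient.mk''_surjective

theorem mk_eq_mk {v w : {v : Fin 2 → ℂ // v ≠ 0}} (h : mk v = mk w) :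
    ∃ a : ℂ, a ≠ 0 ∧ a • w.1 = v.1 := by
  obtain ⟨a, ha⟩ := (Projectivization.mk_eq_mk_iff ℂ v.1 w.1 v.2 w.2).1 h
  exact ⟨a, a.ne_zero, ha⟩

theorem isQuotientMap_mk : Topology.IsQuotientMap mk := ⟨⟨rfl⟩, mk_surjective⟩

/-- The affine coordinate `v_{1-i} / v_i` of `[v₀ : v₁]`. -/
def coord (i : Fin 2) : CP1 → ℂ :=
  Projectivization.lift (fun v => v.1 (1 - i) / v.1 i) (by
    rintro v w t h
    have ht : t ≠ 0 := by
      rintro rfl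
      exact v.2 (by simpa using h)
    simp only [h, Pi.smul_apply, smul_eq_mul]
    exact mul_div_mul_left _ _ ht)

theorem coord_mk (i : Fin 2) (v : {v : Fin 2 → ℂ // v ≠ 0}) :
    coord i (mk v) = v.1 (1 - i) / v.1 i := rfl

/-- The point with `v_{1-i} = z` and `v_i = 1`. -/
def point (i : Fin 2) (z : ℂ) : CP1 :=
  mk ⟨fun j => if j = i then 1 else z, fun h => by simpa using congrFun h i⟩

/-- The open set `{v_i ≠ 0}`. -/
def domain (i : Fin 2) : Set CP1 := {p | ∀ v, mk v = p → v.1 i ≠ 0}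

theorem mk_mem_domain {i : Fin 2} {v : {v : Fin 2 → ℂ // v ≠ 0}} :
    mk v ∈ domain i ↔ v.1 i ≠ 0 := by
  refine ⟨fun h => h v rfl, fun h w hw => ?_⟩
  obtain ⟨a, ha, e⟩ := mk_eq_mk hw
  rw [← e]
  exact mul_ne_zero ha h

theorem one_sub_ne (i : Fin 2) : 1 - i ≠ i := by revert i; decide

theorem eq_or_one_sub (i j : Fin 2) : j = i ∨ j = 1 - i := by revert i j; decide

theorem isOpen_domain (i : Fin 2) : IsOpen (domain i) := by
  rw [← isQuotientMap_mk.isOpen_preimage]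
  have : mk ⁻¹' domain i = {v | v.1 i ≠ 0} := by
    ext v
    exact mk_mem_domain
  rw [this]
  exact isOpen_ne_fun ((continuous_apply i).comp continuous_subtype_val) continuous_const

/-- The affine chart `[v₀ : v₁] ↦ v_{1-i} / v_i` on `{v_i ≠ 0}`. -/
def chart (i : Fin 2) : OpenPartialHomeomorph CP1 ℂ where
  toFun := coord i
  invFun := point i
  source := domain i
  target := Set.univ
  map_source' := fun _ _ => Set.mem_univ _
  map_target' := fun z _ => by
    rw [point, mk_mem_domain]
    simp
  left_inv' := by
    intro p hp
    obtain ⟨v, rfl⟩ := mk_surjective p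
    have h : v.1 i ≠ 0 := mk_mem_domain.1 hp
    refine (Projectivization.mk_eq_mk_iff' ℂ _ _ _ _).2 ⟨(v.1 i)⁻¹, ?_⟩
    funext j
    rcases eq_or_one_sub i j with rfl | rfl
    · simp [h]
    · simp [one_sub_ne, coord_mk, div_eq_inv_mul]
  right_inv' := by
    intro z _
    rw [point, coord_mk]
    simp [one_sub_ne]
  open_source := isOpen_domain i
  open_target := isOpen_univ
  continuousOn_toFun := by
    rw [isQuotientMap_mk.continuousOn_isOpen_iff (isOpen_domain i)]
    have h0 (j : Fin 2) : Continuous fun v : {v : Fin 2 → ℂ // v ≠ 0} => v.1 j :=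
      (continuous_apply j).comp continuous_subtype_val
    exact (h0 (1 - i)).continuousOn.div (h0 i).continuousOn fun v hv => mk_mem_domain.1 hv
  continuousOn_invFun := by
    refine (isQuotientMap_mk.continuous.comp (Continuous.subtype_mk ?_ _)).continuousOn
    refine continuous_pi fun j => ?_
    by_cases h : j = i <;> simp [h, continuous_const, continuous_id']

theorem exists_mem_domain (p : CP1) : ∃ i, p ∈ domain i := by
  obtain ⟨v, rfl⟩ := mk_surjective p
  by_contra! h
  refine v.2 (funext fun i => ?_)
  by_contra hi
  exact h i (mk_mem_domain.2 hi)

/-- The atlas of `ℂP¹` given by the two affine charts. -/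
instance : ChartedSpace ℂ CP1 where
  atlas := Set.range chart
  chartAt p := chart (exists_mem_domain p).choose
  mem_chart_source p := (exists_mem_domain p).choose_spec
  chart_mem_atlas _ := Set.mem_range_self _

/-- `ℂP¹` is a smooth real surface. -/
instance : IsManifold 𝓘(ℝ, ℂ) ∞ CP1 := by
  refine isManifold_of_contDiffOn _ _ _ ?_
  rintro _ _ ⟨i, rfl⟩ ⟨j, rfl⟩
  have hs : 𝓘(ℝ, ℂ).symm ⁻¹' ((chart i).symm ≫ₕ chart j).source ∩ Set.range 𝓘(ℝ, ℂ) ⊆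
      {z | j = i ∨ z ≠ 0} := by
    rintro z ⟨hz, -⟩
    have hz' : point i z ∈ domain j := by simpa [chart] using hz
    rw [point, mk_mem_domain] at hz'
    by_cases h : j = i
    · exact Or.inl h
    · exact Or.inr (by simpa [h] using hz')
  rcases eq_or_one_sub i j with rfl | rfl
  · refine contDiffOn_id.congr fun z _ => ?_
    exact (chart j).right_inv (Set.mem_univ z)
  · refine ContDiffOn.congr (f := fun z : ℂ => z⁻¹) ?_ fun z _ => ?_
    · exact contDiffOn_id.inv fun z hz => (hs hz).resolve_left (one_sub_ne i)
    · change coord (1 - i) (point i z) = z⁻¹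
      rw [point, coord_mk]
      simp [one_sub_ne]

/-- The area form `dx ∧ dy` on `ℂ`. -/
def areaForm : ℂ →L[ℝ] ℂ →L[ℝ] ℝ :=
  Complex.reCLM.smulRight Complex.imCLM - Complex.imCLM.smulRight Complex.reCLM

/-- The Fubini-Study symplectic form on `ℂP¹` of total area `π a²`: it equals
`a² (1 + |z|²)⁻² dx ∧ dy` in each of the two affine coordinates `z = x + iy`
(the two expressions agree under `z ↦ 1 / z`). The map `w ↦ [w : √(a² - |w|²)]`, which
compactifies the open disk of radius `a` to `ℂP¹`, pulls it back to `dx ∧ dy`. -/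
def omega (a : ℝ) : FormField 𝓘(ℝ, ℂ) CP1 := fun p =>
  (a ^ 2 / (1 + ‖chartAt ℂ p p‖ ^ 2) ^ 2) •
    FormField.pullback 𝓘(ℝ, ℂ) 𝓘(ℝ, ℂ) (chartAt ℂ p) (fun _ => areaForm) p

end CP1

/-! ### The torus -/

/-- The lattice `N ℤ²ᵐ` in `ℝ²ᵐ`. -/
def lattice (m : ℕ) (N : ℝ) : AddSubgroup (R2 m) where
  carrier := {v | ∀ i, ∃ k : ℤ, v i = N * k}
  zero_mem' := fun _ => ⟨0, by simp⟩
  add_mem' := by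
    intro u v hu hv i
    obtain ⟨k, hk⟩ := hu i
    obtain ⟨l, hl⟩ := hv i
    exact ⟨k + l, by simp [hk, hl, mul_add]⟩
  neg_mem' := by
    intro v hv i
    obtain ⟨k, hk⟩ := hv i
    exact ⟨-k, by simp [hk]⟩

/-- The torus `T = ℝ²ᵐ / N ℤ²ᵐ` with the quotient topology. -/
def Torus (m : ℕ) (N : ℝ) : Type := R2 m ⧸ lattice m N

namespace Torus

variable {m : ℕ} {N : ℝ}

instance : TopologicalSpace (Torus m N) :=
  inferInstanceAs (TopologicalSpace (R2 m ⧸ lattice m N))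

/-- The projection `ℝ²ᵐ → T`. -/
def proj (m : ℕ) (N : ℝ) : R2 m → Torus m N := fun v => QuotientAddGroup.mk (s := lattice m N) v

theorem proj_surjective : Function.Surjective (proj m N) := QuotientAddGroup.mk_surjective

theorem proj_eq_proj {u v : R2 m} : proj m N u = proj m N v ↔ v - u ∈ lattice m N := by
  rw [sub_eq_neg_add]
  exact QuotientAddGroup.eq

theorem exists_lattice_radius (m : ℕ) (N : ℝ) :
    ∃ r : ℝ, 0 < r ∧ ∀ v ∈ lattice m N, ‖v‖ < r → v = 0 := by
  by_cases hN : N = 0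
  · refine ⟨1, one_pos, fun v hv _ => ?_⟩
    ext i
    obtain ⟨k, hk⟩ := hv i
    simp [hk, hN]
  · refine ⟨|N|, abs_pos.2 hN, fun v hv h => ?_⟩
    ext i
    obtain ⟨k, hk⟩ := hv i
    have h1 : |N| * |(k : ℝ)| < |N| * 1 := by
      rw [← abs_mul, ← hk, mul_one]
      exact (PiLp.norm_apply_le v i).trans_lt h
    have h2 : |(k : ℝ)| < 1 := lt_of_mul_lt_mul_left h1 (abs_nonneg N)
    have h3 : k = 0 := by
      rw [← Int.abs_lt_one_iff]
      exact_mod_cast h2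
    simp [hk, h3]

theorem isDiscrete_lattice : IsDiscrete (lattice m N : Set (R2 m)) := by
  have : DiscreteTopology (lattice m N) := by
    rw [discreteTopology_iff_isOpen_singleton_zero]
    obtain ⟨r, hr, h0⟩ := exists_lattice_radius m N
    have : ({0} : Set (lattice m N)) = Subtype.val ⁻¹' Metric.ball (0 : R2 m) r := by
      ext v
      simp only [Set.mem_singleton_iff, Set.mem_preimage, mem_ball_zero_iff]
      exact ⟨fun h => by simpa [h] using hr, fun h => Subtype.ext (h0 v.1 v.2 h)⟩
    rw [this]
    exact Metric.isOpen_ball.preimage continuous_subtype_val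
  exact ⟨this⟩

theorem isLocalHomeomorph_proj : IsLocalHomeomorph (proj m N) :=
  ((lattice m N).isAddQuotientCoveringMap_of_comm isDiscrete_lattice).isCoveringMap.isLocalHomeomorph

/-- A local inverse of the projection `ℝ²ᵐ → T`, defined near the image of `v` and sending it
to `v`. -/
def chart (v : R2 m) : OpenPartialHomeomorph (Torus m N) (R2 m) :=
  isLocalHomeomorph_proj.localInverseAt v

theorem chart_symm (v : R2 m) : ((chart v).symm : R2 m → Torus m N) = proj m N :=
  isLocalHomeomorph_proj.localInverseAt_symm v

theorem proj_chart (v : R2 m) {q : Torus m N} (hq : q ∈ (chart v).source) :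
    proj m N (chart v q) = q :=
  isLocalHomeomorph_proj.apply_localInverseAt_of_mem hq

theorem proj_mem_chart_source (v : R2 m) : proj m N v ∈ (chart (N := N) v).source :=
  isLocalHomeomorph_proj.apply_self_mem_localInverseAt_source

/-- A lift of a point of `T` to `ℝ²ᵐ`. -/
def lift (q : Torus m N) : R2 m := (proj_surjective q).choose

theorem proj_lift (q : Torus m N) : proj m N (lift q) = q := (proj_surjective q).choose_spec

/-- The atlas of `T` given by local inverses of the projection `ℝ²ᵐ → T`. -/
instance : ChartedSpace (R2 m) (Torus m N) where
  atlas := Set.range chart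
  chartAt q := chart (lift q)
  mem_chart_source q := by
    have h := proj_mem_chart_source (N := N) (lift q)
    rwa [proj_lift] at h
  chart_mem_atlas _ := Set.mem_range_self _

theorem contDiffOn_chart_chart (a b : R2 m) :
    ContDiffOn ℝ ∞ (fun x => chart (N := N) b ((chart a).symm x))
      ((chart (N := N) a).symm ≫ₕ chart b).source := by
  set S := ((chart (N := N) a).symm ≫ₕ chart b).source with hS
  set f : R2 m → R2 m := fun x => chart (N := N) b ((chart a).symm x) with hf
  have key : ∀ x ∈ S, f x - x ∈ lattice m N := by
    intro x hx
    have hx2 : (chart a).symm x ∈ (chart (N := N) b).source := hx.2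
    rw [← proj_eq_proj, hf, proj_chart b hx2, chart_symm]
  have hc : ContinuousOn (fun x => f x - x) S :=
    ((chart (N := N) a).symm ≫ₕ chart b).continuousOn.sub continuousOn_id
  obtain ⟨r, hr, h0⟩ := exists_lattice_radius m N
  intro x hx
  have hev : ∀ᶠ y in 𝓝[S] x, f y = y + (f x - x) := by
    filter_upwards [hc x hx (Metric.ball_mem_nhds _ hr), self_mem_nhdsWithin] with y hy hys
    have h1 := h0 _ (sub_mem (key y hys) (key x hx)) (mem_ball_iff_norm.1 hy)
    rw [sub_eq_zero] at h1
    rw [← h1]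
    abel
  exact (contDiffWithinAt_id.add contDiffWithinAt_const).congr_of_eventuallyEq hev (by simp)

/-- `T` is a smooth manifold. -/
instance : IsManifold 𝓘(ℝ, R2 m) ∞ (Torus m N) := by
  refine isManifold_of_contDiffOn _ _ _ ?_
  rintro _ _ ⟨a, rfl⟩ ⟨b, rfl⟩
  exact (contDiffOn_chart_chart a b).mono fun x hx => hx.1

/-- The symplectic form on `T` induced from the standard one on `ℝ²ᵐ`, that is, its pullback under
any local inverse of the projection `ℝ²ᵐ → T`. -/
def omega (m : ℕ) (N : ℝ) : FormField 𝓘(ℝ, R2 m) (Torus m N) := fun q =>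
  FormField.pullback 𝓘(ℝ, R2 m) 𝓘(ℝ, R2 m) (chartAt (R2 m) q) (fun _ => omegaSt m) q

end Torus

/-- The symplectic form `ω_{ℂP¹} ⊕ ω_T` on `ℂP¹ × T`, where `ℂP¹` has area `π a²`. -/
def omegaProd (a : ℝ) (m : ℕ) (N : ℝ) :
    FormField (𝓘(ℝ, ℂ).prod 𝓘(ℝ, R2 m)) (CP1 × Torus m N) :=
  FormField.prod (CP1.omega a) (Torus.omega m N)

end

/-! Any two complex structures `J₀`, `J` compatible with the same linear symplectic form σ are
joined by an explicit path of compatible structures, `Q J Q⁻¹` with `Q = 1 - s J₀ J`. It equals `J`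
at `s = 0` and `J₀` at `s = 1`, and it is built from `J₀`, `J`, `s` by products and one operator
inverse, so it depends smoothly on all three. It is also equivariant under linear isomorphisms,
hence makes sense on tangent spaces.

The lemma follows by a cutoff. On `ℂP¹ × T` the product of the two standard structures is a
compatible `J₀`. On the image of the open ball of radius `R` the push-forward of `J_st` is a second
compatible structure, since φ is symplectic and, by equality of dimensions, has invertible
derivative. Taking for `s` a function of the point of the ball that is 0 up to radius `R'` and 1
beyond some ρ < R gives a structure that is standard on the image of the small ball. Off the image
of the closed ρ-ball, which is closed because it is compact in a Hausdorff space, it agrees with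
`J₀`, so it extends smoothly to the whole manifold.

The linear part rests on `IsLinearCompatible.interpolate`, the gluing is
`exists_isCompatible_extending_JSt`, and the background structure is `productComplexStructure`. -/

noncomputable section

/-! ### Interpolation between compatible complex structures -/

section Linear

variable {E : Type*} [NormedAddCommGroup E] [NormedSpace ℝ E]

/-- `J` is a complex structure on `E` for which `σ(·, J ·)` is an inner product. -/
structure IsLinearCompatible (σ : E →L[ℝ] E →L[ℝ] ℝ) (J : E →L[ℝ] E) : Prop where
  sq : ∀ v, J (J v) = -v
  symm : ∀ u v, σ u (J v) = σ v (J u)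
  pos : ∀ v, v ≠ 0 → 0 < σ v (J v)

/-- The endomorphism `1 - s J₀ J`. -/
def intertwiner (J₀ J : E →L[ℝ] E) (s : ℝ) : E →L[ℝ] E :=
  ContinuousLinearMap.id ℝ E - s • (J₀ ∘L J)

/-- The path `s ↦ Q J Q⁻¹`, `Q = 1 - s J₀ J`, of complex structures, which joins `J` (at `s = 0`)
to `J₀` (at `s = 1`). It is the path of the Cayley transforms of `-J₀ J`. -/
def interpolate (J₀ J : E →L[ℝ] E) (s : ℝ) : E →L[ℝ] E :=
  intertwiner J₀ J s ∘L J ∘L (intertwiner J₀ J s).inverse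

theorem intertwiner_apply (J₀ J : E →L[ℝ] E) (s : ℝ) (v : E) :
    intertwiner J₀ J s v = v - s • J₀ (J v) := rfl

theorem IsLinearCompatible.map_map {σ : E →L[ℝ] E →L[ℝ] ℝ} {J : E →L[ℝ] E}
    (h : IsLinearCompatible σ J) (hσ : ∀ u v, σ u v = -σ v u) (u v : E) :
    σ (J u) (J v) = σ u v := by
  rw [h.symm, h.sq, map_neg, hσ u v]

/-- Each of the four terms on the right is symmetric in `u`, `v` and, for `u = v` and `s ≥ 0`,
nonnegative. Hence one expansion yields both the symmetry and the positivity of the interpolated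
structure. -/
theorem IsLinearCompatible.intertwiner_intertwiner {σ : E →L[ℝ] E →L[ℝ] ℝ} {J₀ J : E →L[ℝ] E}
    (h₀ : IsLinearCompatible σ J₀) (h : IsLinearCompatible σ J) (hσ : ∀ u v, σ u v = -σ v u)
    (s : ℝ) (u v : E) :
    σ (intertwiner J₀ J s u) (intertwiner J₀ J s (J v)) =
      σ u (J v) + s * σ u (J₀ v) + s * σ (J v) (J₀ (J u)) + s ^ 2 * σ v (J u) := by
  have h1 : σ (J₀ (J u)) (J v) = -σ (J v) (J₀ (J u)) := hσ _ _
  have h2 : σ (J₀ (J u)) (J₀ v) = -σ v (J u) := by rw [h₀.map_map hσ, hσ]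
  simp only [intertwiner_apply, h.sq, map_neg, smul_neg, sub_neg_eq_add, map_add, map_sub,
    map_smul, sub_apply, smul_apply, smul_eq_mul, h1, h2]
  ring

theorem IsLinearCompatible.intertwiner_pos {σ : E →L[ℝ] E →L[ℝ] ℝ} {J₀ J : E →L[ℝ] E}
    (h₀ : IsLinearCompatible σ J₀) (h : IsLinearCompatible σ J) (hσ : ∀ u v, σ u v = -σ v u)
    {s : ℝ} (hs : 0 ≤ s) {v : E} (hv : v ≠ 0) :
    0 < σ (intertwiner J₀ J s v) (intertwiner J₀ J s (J v)) := by
  rw [h₀.intertwiner_intertwiner h hσ]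
  have hJv : J v ≠ 0 := fun h' => hv (by simpa [h'] using h.sq v)
  have h1 := h.pos v hv
  have h2 := h₀.pos v hv
  have h3 := h₀.pos _ hJv
  positivity

/-- If `Q v = 0` with `v ≠ 0`, then `σ(Q v, Q J v) = 0`, against `intertwiner_pos`. So `Q` is
injective, and finite dimension does the rest. -/
theorem IsLinearCompatible.isInvertible_intertwiner [FiniteDimensional ℝ E]
    {σ : E →L[ℝ] E →L[ℝ] ℝ} {J₀ J : E →L[ℝ] E}
    (h₀ : IsLinearCompatible σ J₀) (h : IsLinearCompatible σ J) (hσ : ∀ u v, σ u v = -σ v u)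
    {s : ℝ} (hs : 0 ≤ s) : (intertwiner J₀ J s).IsInvertible := by
  have hinj : Function.Injective (intertwiner J₀ J s : E →ₗ[ℝ] E) := by
    rw [← LinearMap.ker_eq_bot, LinearMap.ker_eq_bot']
    intro v hv
    by_contra hne
    have h1 := h₀.intertwiner_pos h hσ hs hne
    rw [show intertwiner J₀ J s v = 0 from hv] at h1
    simp at h1
  exact ⟨(LinearEquiv.ofInjectiveEndo _ hinj).toContinuousLinearEquiv, rfl⟩

theorem interpolate_intertwiner {J₀ J : E →L[ℝ] E} {s : ℝ}
    (hQ : (intertwiner J₀ J s).IsInvertible) (v : E) :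
    interpolate J₀ J s (intertwiner J₀ J s v) = intertwiner J₀ J s (J v) := by
  simp [interpolate, hQ.inverse_apply_eq.2 rfl]

/-- Every vector has the form `Q w`, and the new structure sends `Q w` to `Q J w`; each axiom thus
becomes a statement about `σ(Q z, Q J w)`. -/
theorem IsLinearCompatible.interpolate [FiniteDimensional ℝ E]
    {σ : E →L[ℝ] E →L[ℝ] ℝ} {J₀ J : E →L[ℝ] E}
    (h₀ : IsLinearCompatible σ J₀) (h : IsLinearCompatible σ J) (hσ : ∀ u v, σ u v = -σ v u)
    {s : ℝ} (hs : 0 ≤ s) : IsLinearCompatible σ (interpolate J₀ J s) := by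
  have hQ := h₀.isInvertible_intertwiner h hσ hs
  have hsurj : Function.Surjective (intertwiner J₀ J s) := hQ.bijective.2
  refine ⟨fun v => ?_, fun u v => ?_, fun v hv => ?_⟩
  · obtain ⟨w, rfl⟩ := hsurj v
    simp [interpolate_intertwiner hQ, h.sq]
  · obtain ⟨w, rfl⟩ := hsurj v
    obtain ⟨z, rfl⟩ := hsurj u
    simp only [interpolate_intertwiner hQ, h₀.intertwiner_intertwiner h hσ]
    rw [h.symm z w, h₀.symm z w, h₀.symm (J w) (J z)]
  · obtain ⟨w, rfl⟩ := hsurj v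
    rw [interpolate_intertwiner hQ]
    exact h₀.intertwiner_pos h hσ hs fun h' => hv (by simp [h'])

theorem interpolate_zero (J₀ J : E →L[ℝ] E) : interpolate J₀ J 0 = J := by
  have : intertwiner J₀ J 0 = ContinuousLinearMap.id ℝ E := by simp [intertwiner]
  ext v
  simp [interpolate, this]

/-- At `s = 1`, both `Q J` and `J₀ Q` equal `J + J₀`, because `J² = J₀² = -1`. -/
theorem IsLinearCompatible.interpolate_one [FiniteDimensional ℝ E]
    {σ : E →L[ℝ] E →L[ℝ] ℝ} {J₀ J : E →L[ℝ] E}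
    (h₀ : IsLinearCompatible σ J₀) (h : IsLinearCompatible σ J) (hσ : ∀ u v, σ u v = -σ v u) :
    _root_.interpolate J₀ J 1 = J₀ := by
  have hQ := h₀.isInvertible_intertwiner h hσ zero_le_one
  ext v
  obtain ⟨w, rfl⟩ := hQ.bijective.2 v
  rw [interpolate_intertwiner hQ]
  simp [intertwiner_apply, h.sq, h₀.sq, add_comm]

variable {F : Type*} [NormedAddCommGroup F] [NormedSpace ℝ F]

theorem intertwiner_conj (e : E ≃L[ℝ] F) (J₀ J : E →L[ℝ] E) (s : ℝ) :
    intertwiner ((e : E →L[ℝ] F) ∘L J₀ ∘L (e.symm : F →L[ℝ] E))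
        ((e : E →L[ℝ] F) ∘L J ∘L (e.symm : F →L[ℝ] E)) s =
      (e : E →L[ℝ] F) ∘L intertwiner J₀ J s ∘L (e.symm : F →L[ℝ] E) := by
  ext v
  simp [intertwiner]

theorem interpolate_conj (e : E ≃L[ℝ] F) (J₀ J : E →L[ℝ] E) (s : ℝ) :
    interpolate ((e : E →L[ℝ] F) ∘L J₀ ∘L (e.symm : F →L[ℝ] E))
        ((e : E →L[ℝ] F) ∘L J ∘L (e.symm : F →L[ℝ] E)) s =
      (e : E →L[ℝ] F) ∘L interpolate J₀ J s ∘L (e.symm : F →L[ℝ] E) := by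
  rw [interpolate, intertwiner_conj, ContinuousLinearMap.inverse_equiv_comp,
    ContinuousLinearMap.inverse_comp_equiv]
  ext v
  simp [interpolate]

theorem ContDiffAt.interpolate [CompleteSpace E] {n : WithTop ℕ∞} {J₀ J : F → E →L[ℝ] E}
    {s : F → ℝ} {x : F} (h₀ : ContDiffAt ℝ n J₀ x) (h : ContDiffAt ℝ n J x)
    (hs : ContDiffAt ℝ n s x) (hQ : (intertwiner (J₀ x) (J x) (s x)).IsInvertible) :
    ContDiffAt ℝ n (fun y => _root_.interpolate (J₀ y) (J y) (s y)) x := by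
  have hq : ContDiffAt ℝ n (fun y => intertwiner (J₀ y) (J y) (s y)) x :=
    contDiffAt_const.sub (hs.smul (h₀.clm_comp h))
  obtain ⟨e, he⟩ := hQ
  have hi : ContDiffAt ℝ n (fun y => (intertwiner (J₀ y) (J y) (s y)).inverse) x := by
    refine ContDiffAt.comp x (g := ContinuousLinearMap.inverse) ?_ hq
    rw [← he]
    exact contDiffAt_map_inverse e
  exact hq.clm_comp (h.clm_comp hi)

end Linear

/-! ### The standard structure on `ℝ²ⁿ` -/

theorem omegaSt_apply (n : ℕ) (u v : R2 n) :
    omegaSt n u v = ∑ i, (u (i, 0) * v (i, 1) - u (i, 1) * v (i, 0)) := by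
  simp [omegaSt]

theorem omegaSt_antisymm (n : ℕ) (u v : R2 n) : omegaSt n u v = -omegaSt n v u := by
  rw [omegaSt_apply, omegaSt_apply, ← Finset.sum_neg_distrib]
  exact Finset.sum_congr rfl fun i _ => by ring

theorem JSt_apply_zero (n : ℕ) (v : R2 n) (i : Fin n) : JSt n v (i, 0) = -v (i, 1) := by
  simp [JSt]

theorem JSt_apply_one (n : ℕ) (v : R2 n) (i : Fin n) : JSt n v (i, 1) = v (i, 0) := by
  simp [JSt]

theorem isLinearCompatible_JSt (n : ℕ) : IsLinearCompatible (omegaSt n) (JSt n) where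
  sq v := by
    ext ⟨i, j⟩
    fin_cases j
    · simpa [JSt_apply_one] using JSt_apply_zero n (JSt n v) i
    · simpa [JSt_apply_zero] using JSt_apply_one n (JSt n v) i
  symm u v := by
    simp only [omegaSt_apply, JSt_apply_zero, JSt_apply_one]
    exact Finset.sum_congr rfl fun i _ => by ring
  pos v hv := by
    simp only [omegaSt_apply, JSt_apply_zero, JSt_apply_one]
    have hnn : ∀ i : Fin n, 0 ≤ v (i, 0) * v (i, 0) - v (i, 1) * -v (i, 1) := fun i => by
      nlinarith [mul_self_nonneg (v (i, 0)), mul_self_nonneg (v (i, 1))]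
    obtain ⟨⟨i, j⟩, hij⟩ : ∃ p, v p ≠ 0 := by
      by_contra! h
      exact hv (by ext p; simpa using h p)
    refine Finset.sum_pos' (fun i _ => hnn i) ⟨i, Finset.mem_univ _, ?_⟩
    have h0 := mul_self_nonneg (v (i, 0))
    have h1 := mul_self_nonneg (v (i, 1))
    have h2 := mul_self_pos.2 hij
    fin_cases j
    · simp only [Fin.zero_eta] at h2
      linarith
    · simp only [Fin.mk_one] at h2
      linarith

/-! ### Pushing forward complex structures -/

section Linear

variable {E : Type*} [NormedAddCommGroup E] [NormedSpace ℝ E]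
  {F : Type*} [NormedAddCommGroup F] [NormedSpace ℝ F]

/-- The endomorphism `D J D⁻¹`. -/
def pushforward (D : F →L[ℝ] E) (J : F →L[ℝ] F) : E →L[ℝ] E := D ∘L J ∘L D.inverse

theorem pushforward_map {D : F →L[ℝ] E} (hD : D.IsInvertible) (J : F →L[ℝ] F) (v : F) :
    pushforward D J (D v) = D (J v) := by
  simp [pushforward, hD.inverse_apply_eq.2 rfl]

theorem IsLinearCompatible.pushforward {σ : E →L[ℝ] E →L[ℝ] ℝ} {τ : F →L[ℝ] F →L[ℝ] ℝ}
    {J : F →L[ℝ] F} (h : IsLinearCompatible τ J) {D : F →L[ℝ] E} (hD : D.IsInvertible)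
    (hστ : ∀ u v, σ (D u) (D v) = τ u v) : IsLinearCompatible σ (pushforward D J) := by
  refine ⟨fun v => ?_, fun u v => ?_, fun v hv => ?_⟩
  · obtain ⟨w, rfl⟩ := hD.bijective.2 v
    simp [pushforward_map hD, h.sq]
  · obtain ⟨w, rfl⟩ := hD.bijective.2 v
    obtain ⟨z, rfl⟩ := hD.bijective.2 u
    simp [pushforward_map hD, hστ, h.symm z w]
  · obtain ⟨w, rfl⟩ := hD.bijective.2 v
    rw [pushforward_map hD, hστ]
    exact h.pos w fun h' => hv (by simp [h'])

/-- The compatible `J` serves only to witness that τ is nondegenerate: a vector killed by `D` would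
have `τ(v, J v) = 0`. -/
theorem IsLinearCompatible.isInvertible_of_map_eq [FiniteDimensional ℝ E] [FiniteDimensional ℝ F]
    {σ : E →L[ℝ] E →L[ℝ] ℝ} {τ : F →L[ℝ] F →L[ℝ] ℝ}
    {J : F →L[ℝ] F} (h : IsLinearCompatible τ J) {D : F →L[ℝ] E}
    (hστ : ∀ u v, σ (D u) (D v) = τ u v)
    (hd : Module.finrank ℝ F = Module.finrank ℝ E) : D.IsInvertible := by
  have hinj : Function.Injective (D : F →ₗ[ℝ] E) := by
    rw [← LinearMap.ker_eq_bot, LinearMap.ker_eq_bot']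
    intro v hv
    by_contra hne
    have h1 := h.pos v hne
    rw [← hστ, show D v = 0 from hv] at h1
    simp at h1
  exact ⟨(LinearEquiv.ofInjectiveOfFinrankEq _ hinj hd).toContinuousLinearEquiv, rfl⟩

theorem pushforward_comp {G : Type*} [NormedAddCommGroup G] [NormedSpace ℝ G]
    {C : E →L[ℝ] G} (hC : C.IsInvertible) (D : F →L[ℝ] E) (J : F →L[ℝ] F) :
    pushforward (C ∘L D) J = pushforward C (pushforward D J) := by
  obtain ⟨e, rfl⟩ := hC
  ext v
  simp [pushforward]

/-- Applied with `C` the derivative of a chart, this turns an interpolation on tangent spaces into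
one in a fixed vector space, where smoothness can be tested. -/
theorem pushforward_interpolate {C : E →L[ℝ] F} (hC : C.IsInvertible) (J₀ J : E →L[ℝ] E) (s : ℝ) :
    pushforward C (interpolate J₀ J s) = interpolate (pushforward C J₀) (pushforward C J) s := by
  obtain ⟨e, rfl⟩ := hC
  simp only [pushforward, ContinuousLinearMap.inverse_equiv]
  exact (interpolate_conj e J₀ J s).symm

theorem pushforward_intertwiner {C : E →L[ℝ] F} (hC : C.IsInvertible) (J₀ J : E →L[ℝ] E) (s : ℝ) :
    pushforward C (intertwiner J₀ J s) = intertwiner (pushforward C J₀) (pushforward C J) s := by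
  obtain ⟨e, rfl⟩ := hC
  simp only [pushforward, ContinuousLinearMap.inverse_equiv]
  exact (intertwiner_conj e J₀ J s).symm

theorem isInvertible_pushforward {C : E →L[ℝ] F} (hC : C.IsInvertible) {A : E →L[ℝ] E}
    (hA : A.IsInvertible) : (pushforward C A).IsInvertible := by
  obtain ⟨e, rfl⟩ := hC
  obtain ⟨A, rfl⟩ := hA
  exact ⟨e.symm.trans (A.trans e), by ext v; simp [pushforward]⟩

theorem ContDiffAt.pushforward {G : Type*} [NormedAddCommGroup G] [NormedSpace ℝ G]
    [CompleteSpace F] {k : WithTop ℕ∞} {D : G → F →L[ℝ] E} {J : G → F →L[ℝ] F} {x : G}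
    (hD : ContDiffAt ℝ k D x) (hJ : ContDiffAt ℝ k J x) (h : (D x).IsInvertible) :
    ContDiffAt ℝ k (fun y => _root_.pushforward (D y) (J y)) x := by
  obtain ⟨e, he⟩ := h
  have hi : ContDiffAt ℝ k (fun y => (D y).inverse) x := by
    refine ContDiffAt.comp x (g := ContinuousLinearMap.inverse) ?_ hD
    rw [← he]
    exact contDiffAt_map_inverse e
  exact hD.clm_comp (hJ.clm_comp hi)

end Linear

/-! ### Smoothness of endomorphism fields in charts -/

section Manifolds

variable {E : Type*} [NormedAddCommGroup E] [NormedSpace ℝ E]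
  {H : Type*} [TopologicalSpace H] {I : ModelWithCorners ℝ E H}
  {M : Type*} [TopologicalSpace M] [ChartedSpace H M]

/-- The derivative at `q` of the preferred chart at `p`. -/
def chartDeriv (I : ModelWithCorners ℝ E H) {M : Type*} [TopologicalSpace M] [ChartedSpace H M]
    (p q : M) : E →L[ℝ] E :=
  mfderiv I 𝓘(ℝ, E) (extChartAt I p) q

variable [IsManifold I ∞ M]

theorem isInvertible_chartDeriv {p q : M} (hq : q ∈ (chartAt H p).source) :
    (chartDeriv I p q).IsInvertible := by
  have : IsManifold I 1 M := IsManifold.of_le (n := ∞) (by simp)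
  exact isInvertible_mfderiv_extChartAt (by simpa using hq)

/-- Near `p` the trivialization of the tangent bundle is the derivative of the chart at `p`, and the
induced trivialization of the endomorphism bundle is conjugation by it. -/
theorem contMDiffAt_endomorphism_iff {A : ∀ x : M, TangentSpace I x →L[ℝ] TangentSpace I x}
    {p : M} :
    ContMDiffAt I (I.prod 𝓘(ℝ, E →L[ℝ] E)) ∞
      (fun x => Bundle.TotalSpace.mk' (E →L[ℝ] E)
        (E := fun x : M => TangentSpace I x →L[ℝ] TangentSpace I x) x (A x)) p ↔
    ContMDiffAt I 𝓘(ℝ, E →L[ℝ] E) ∞ (fun q => pushforward (chartDeriv I p q) (A q)) p := by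
  have : IsManifold I 1 M := IsManifold.of_le (n := ∞) (by simp)
  rw [contMDiffAt_hom_bundle]
  refine (and_iff_right contMDiffAt_id).trans ?_
  refine Filter.EventuallyEq.contMDiffAt_iff ?_
  filter_upwards [(chartAt H p).open_source.mem_nhds (mem_chart_source H p)] with q hq
  have hb : q ∈ (trivializationAt E (TangentSpace I) p).baseSet := by simpa using hq
  rw [ContinuousLinearMap.inCoordinates_eq hb hb]
  have h1 : (((trivializationAt E (TangentSpace I) p).continuousLinearEquivAt ℝ q hb :
      TangentSpace I q ≃L[ℝ] E) : TangentSpace I q →L[ℝ] E) = chartDeriv I p q := by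
    rw [chartDeriv, ← TangentBundle.continuousLinearMapAt_trivializationAt hq]
    ext v
    simp [Bundle.Trivialization.coe_linearMapAt_of_mem _ hb]
  have h2 : (((trivializationAt E (TangentSpace I) p).continuousLinearEquivAt ℝ q hb).symm :
      E →L[ℝ] TangentSpace I q) = (chartDeriv I p q).inverse := by
    rw [← h1]
    exact (ContinuousLinearMap.inverse_equiv _).symm
  rw [h1, h2]
  rfl

end Manifolds

/-! ### Local inverses and gluing along an embedded ball -/

section Manifolds

variable {E : Type*} [NormedAddCommGroup E] [NormedSpace ℝ E]
  {H : Type*} [TopologicalSpace H] {I : ModelWithCorners ℝ E H}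
  {M : Type*} [TopologicalSpace M] [ChartedSpace H M]
  {F : Type*} [NormedAddCommGroup F] [NormedSpace ℝ F]

/-- The derivative of a map from a vector space to a manifold. -/
def vectorDeriv (I : ModelWithCorners ℝ E H) {M : Type*} [TopologicalSpace M] [ChartedSpace H M]
    (f : F → M) (x : F) : F →L[ℝ] E :=
  mfderiv 𝓘(ℝ, F) I f x

variable [IsManifold I ∞ M]

theorem contDiffAt_extChartAt_comp {f : F → M} {x : F} {p : M}
    (hf : ContMDiffAt 𝓘(ℝ, F) I ∞ f x) (hx : f x ∈ (chartAt H p).source) :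
    ContDiffAt ℝ ∞ (extChartAt I p ∘ f) x :=
  ((contMDiffAt_extChartAt' hx).comp x hf).contDiffAt

theorem fderiv_extChartAt_comp {f : F → M} {x : F} {p : M}
    (hf : ContMDiffAt 𝓘(ℝ, F) I ∞ f x) (hx : f x ∈ (chartAt H p).source) :
    fderiv ℝ (extChartAt I p ∘ f) x = chartDeriv I p (f x) ∘L vectorDeriv I f x := by
  rw [← mfderiv_eq_fderiv]
  exact mfderiv_comp x ((contMDiffAt_extChartAt' (n := ∞) hx).mdifferentiableAt (by simp))
    (hf.mdifferentiableAt (by simp))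

/-- A left inverse of a map which is injective on an open set and an immersion at a point of it,
into a manifold of the same dimension, is smooth at the image of that point, and the image of the
open set is a neighbourhood. -/
theorem contMDiffAt_leftInverse [I.Boundaryless] [CompleteSpace F] {f : F → M} {U : Set F}
    (hU : IsOpen U) {x : F} (hx : x ∈ U) (hf : ContMDiffAt 𝓘(ℝ, F) I ∞ f x)
    (hD : (vectorDeriv I f x).IsInvertible) {g : M → F} (hg : ∀ y ∈ U, g (f y) = y) :
    ContMDiffAt I 𝓘(ℝ, F) ∞ g (f x) ∧ f '' U ∈ 𝓝 (f x) := by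
  have hs := mem_chart_source H (f x)
  have hc := contDiffAt_extChartAt_comp hf hs
  obtain ⟨e, he⟩ : (fderiv ℝ (extChartAt I (f x) ∘ f) x).IsInvertible := by
    rw [fderiv_extChartAt_comp hf hs]
    exact (isInvertible_chartDeriv hs).comp hD
  have hd : HasFDerivAt (extChartAt I (f x) ∘ f) (e : F →L[ℝ] E) x := by
    rw [he]
    exact (hc.differentiableAt (by simp)).hasFDerivAt
  set k : E → F := hc.localInverse hd (by simp) with hk
  have hkx : k (extChartAt I (f x) (f x)) = x := hc.localInverse_apply_image hd (by simp)
  have hks : ContDiffAt ℝ ∞ k (extChartAt I (f x) (f x)) := hc.to_localInverse hd (by simp)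
  have hke : ContMDiffAt I 𝓘(ℝ, F) ∞ (k ∘ extChartAt I (f x)) (f x) :=
    hks.contMDiffAt.comp _ contMDiffAt_extChartAt
  have hright : ∀ᶠ y in 𝓝 (extChartAt I (f x) (f x)), extChartAt I (f x) (f (k y)) = y :=
    (hc.hasStrictFDerivAt' hd (by simp)).eventually_right_inverse
  have hkt : Filter.Tendsto (k ∘ extChartAt I (f x)) (𝓝 (f x)) (𝓝 x) := by
    have := hke.continuousAt.tendsto
    rwa [Function.comp_apply, hkx] at this
  have hft : Filter.Tendsto (fun q => f (k (extChartAt I (f x) q))) (𝓝 (f x)) (𝓝 (f x)) :=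
    hf.continuousAt.tendsto.comp hkt
  -- The local inverse `k` only inverts `f` read in the chart; injectivity of the chart on its
  -- source upgrades this to `f (k (chart q)) = q`. This identifies `g` with `k ∘ chart` near `f x`.
  have key : ∀ᶠ q in 𝓝 (f x), k (extChartAt I (f x) q) ∈ U ∧
      f (k (extChartAt I (f x) q)) = q := by
    filter_upwards [hkt (hU.mem_nhds hx), hft (extChartAt_source_mem_nhds (I := I) (f x)),
      extChartAt_source_mem_nhds (I := I) (f x),
      (continuousAt_extChartAt (I := I) (f x)).eventually hright] with q h1 h2 h3 h4
    exact ⟨h1, (extChartAt I (f x)).injOn h2 h3 h4⟩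
  constructor
  · refine hke.congr_of_eventuallyEq ?_
    filter_upwards [key] with q hq
    conv_lhs => rw [← hq.2]
    exact hg _ hq.1
  · filter_upwards [key] with q hq
    exact ⟨_, hq.1, hq.2⟩

/-- The endomorphisms of the model space that an almost complex structure gives in the preferred
charts. -/
def AlmostComplexStructure.coordFun (J : AlmostComplexStructure I M) (x : M) : E →L[ℝ] E :=
  J.toFun x

theorem AlmostComplexStructure.IsCompatible.isLinearCompatible {J : AlmostComplexStructure I M}
    {σ : FormField I M} (h : J.IsCompatible σ) (x : M) :
    IsLinearCompatible (E := E) (σ x) (J.coordFun x) :=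
  ⟨J.sq_eq_neg x, h.symm x, h.pos x⟩

/-- A smooth function that vanishes on the ball of radius `r` and equals `1` outside the ball of
radius `ρ`. -/
theorem exists_smooth_cutoff [HasContDiffBump F] {r ρ : ℝ} (hr : 0 < r)
    (hρ : r < ρ) :
    ∃ s : F → ℝ, ContDiff ℝ ∞ s ∧ (∀ x, 0 ≤ s x) ∧ (∀ x ∈ Metric.closedBall 0 r, s x = 0) ∧
      ∀ x ∉ Metric.closedBall 0 ρ, s x = 1 := by
  let b : ContDiffBump (0 : F) := ⟨r, ρ, hr, hρ⟩
  refine ⟨fun x => 1 - b x, contDiff_const.sub b.contDiff, fun x => sub_nonneg.2 b.le_one,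
    fun x hx => ?_, fun x hx => ?_⟩
  · simp [b.one_of_mem_closedBall hx]
  · have : ρ ≤ dist x 0 := by
      rw [Metric.mem_closedBall, not_le] at hx
      exact hx.le
    simp [b.zero_of_le_dist this]

/-- A compatible almost complex structure can be changed so that it becomes standard on the image
of a symplectically embedded ball, provided that the embedding extends to a larger ball. -/
theorem exists_isCompatible_extending_JSt [I.Boundaryless] [T2Space M] [FiniteDimensional ℝ E]
    {σ : FormField I M} (hσ : ∀ (x : M) (u v : TangentSpace I x), σ x u v = -σ x v u)
    {J₀ : AlmostComplexStructure I M} (h₀ : J₀.IsCompatible σ) {n : ℕ}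
    (hn : Module.finrank ℝ (R2 n) = Module.finrank ℝ E) {r R : ℝ} (hr : 0 < r) (hR : r < R)
    {φ : R2 n → M} (hφ : IsSymplecticEmbeddingOn I φ (Metric.closedBall 0 R) σ) :
    ∃ J : AlmostComplexStructure I M, J.IsCompatible σ ∧
      ∀ x ∈ Metric.closedBall (0 : R2 n) r, ∀ v : R2 n,
        J.toFun (φ x) (mfderiv 𝓘(ℝ, R2 n) I φ x v) = mfderiv 𝓘(ℝ, R2 n) I φ x (JSt n v) := by
  classical
  -- The gap between ρ and `R` makes the two descriptions of the glued structure overlap on an open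
  -- set.
  obtain ⟨ρ, hrρ, hρR⟩ := exists_between hR
  obtain ⟨s, hs, hs0, hsr, hsρ⟩ := exists_smooth_cutoff (F := R2 n) hr hrρ
  set U : Set (R2 n) := Metric.ball 0 R with hU
  have hUo : IsOpen U := Metric.isOpen_ball
  have hnhds : ∀ x ∈ U, Metric.closedBall (0 : R2 n) R ∈ 𝓝 x := fun x hx =>
    Filter.mem_of_superset (hUo.mem_nhds hx) Metric.ball_subset_closedBall
  have hρU : Metric.closedBall (0 : R2 n) ρ ⊆ U := Metric.closedBall_subset_ball hρR
  have hsm : ∀ x ∈ U, ContMDiffAt 𝓘(ℝ, R2 n) I ∞ φ x := fun x hx =>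
    hφ.contMDiffOn.contMDiffAt (hnhds x hx)
  have hinj : Set.InjOn φ U :=
    (Set.injOn_iff_injective.2 hφ.isEmbedding.injective).mono Metric.ball_subset_closedBall
  have hpull : ∀ x ∈ U, ∀ u v, (σ (φ x) : E →L[ℝ] E →L[ℝ] ℝ) (vectorDeriv I φ x u)
      (vectorDeriv I φ x v) = omegaSt n u v := fun x hx u v => by
    have := hφ.pullback_eq x (Metric.ball_subset_closedBall hx) u v
    rwa [mfderivWithin_of_mem_nhds (hnhds x hx)] at this
  have hD : ∀ x ∈ U, (vectorDeriv I φ x).IsInvertible := fun x hx =>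
    (isLinearCompatible_JSt n).isInvertible_of_map_eq (E := E) (σ := σ (φ x)) (hpull x hx) hn
  have hJφ : ∀ x ∈ U, IsLinearCompatible (E := E) (σ (φ x))
      (pushforward (vectorDeriv I φ x) (JSt n)) :=
    fun x hx => (isLinearCompatible_JSt n).pushforward (hD x hx) (hpull x hx)
  -- the almost complex structure along `φ`, and a left inverse of `φ`
  let K : R2 n → E →L[ℝ] E := fun x =>
    interpolate (J₀.coordFun (φ x)) (pushforward (vectorDeriv I φ x) (JSt n)) (s x)
  have hK : ∀ x ∈ U, IsLinearCompatible (E := E) (σ (φ x)) (K x) := fun x hx =>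
    (h₀.isLinearCompatible (φ x)).interpolate (hJφ x hx) (hσ (φ x)) (hs0 x)
  let X : M → R2 n := Function.invFunOn φ U
  have hX : ∀ x ∈ U, X (φ x) = x := fun x hx => hinj.leftInvOn_invFunOn hx
  -- `X` and `K` are used only on `φ '' U` and on `U` respectively, so their arbitrary values
  -- elsewhere do not enter.
  let J : M → E →L[ℝ] E := fun p =>
    if p ∈ φ '' U then K (X p) else J₀.coordFun p
  have hJU : ∀ x ∈ U, J (φ x) = K x := fun x hx => by
    simp only [J, if_pos (Set.mem_image_of_mem φ hx), hX x hx]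
  -- On the shell between radii ρ and `R` the cutoff is 1, so the interpolation already returns
  -- `J₀`.
  have hJout : ∀ p ∉ φ '' Metric.closedBall 0 ρ, J p = J₀.coordFun p := fun p hp => by
    by_cases hpU : p ∈ φ '' U
    · obtain ⟨x, hx, rfl⟩ := hpU
      have hx' : x ∉ Metric.closedBall 0 ρ := fun h => hp (Set.mem_image_of_mem φ h)
      rw [hJU x hx]
      simp only [K, hsρ x hx']
      exact (h₀.isLinearCompatible (φ x)).interpolate_one (hJφ x hx) (hσ (φ x))
    · simp only [J, if_neg hpU]
  have hJc : ∀ p, IsLinearCompatible (E := E) (σ p) (J p) := fun p => by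
    by_cases hpU : p ∈ φ '' U
    · obtain ⟨x, hx, rfl⟩ := hpU
      rw [hJU x hx]
      exact hK x hx
    · simp only [J, if_neg hpU]
      exact h₀.isLinearCompatible p
  have hclosed : IsClosed (φ '' Metric.closedBall 0 ρ) :=
    ((isCompact_closedBall _ _).image_of_continuousOn fun x hx =>
      (hsm x (hρU hx)).continuousAt.continuousWithinAt).isClosed
  refine ⟨⟨J, fun p => ?_, fun p => (hJc p).sq⟩, ⟨fun p => (hJc p).symm, fun p => (hJc p).pos⟩,
    fun x hx v => ?_⟩
  · by_cases hp : p ∈ φ '' Metric.closedBall 0 ρ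
    · obtain ⟨x, hx, rfl⟩ := hp
      replace hx := hρU hx
      obtain ⟨hXs, hXU⟩ := contMDiffAt_leftInverse hUo hx (hsm x hx) (hD x hx) hX
      have hsrc := mem_chart_source H (φ x)
      refine contMDiffAt_endomorphism_iff.2 ?_
      have hJ₀ : ContMDiffAt I 𝓘(ℝ, E →L[ℝ] E) ∞
          (fun q => pushforward (chartDeriv I (φ x) q) (J₀.coordFun q)) (φ x) :=
        contMDiffAt_endomorphism_iff.1 (J₀.contMDiff (φ x))
      -- `G` is the glued structure in the chart at `φ x`, as a function on the ball. By naturality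
      -- it involves only the coordinate form of `J₀` and the ordinary derivative of φ in the chart.
      -- Composing with the smooth inverse `X` returns to the manifold.
      let G : R2 n → E →L[ℝ] E := fun y =>
        interpolate (pushforward (chartDeriv I (φ x) (φ y)) (J₀.coordFun (φ y)))
          (pushforward (fderiv ℝ (extChartAt I (φ x) ∘ φ) y) (JSt n)) (s y)
      have hG : ∀ y ∈ U, φ y ∈ (chartAt H (φ x)).source →
          G y = pushforward (chartDeriv I (φ x) (φ y)) (K y) := fun y hy hys => by
        simp only [G, K]
        rw [pushforward_interpolate (isInvertible_chartDeriv hys),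
          fderiv_extChartAt_comp (hsm y hy) hys, pushforward_comp (isInvertible_chartDeriv hys)]
      have hGs : ContDiffAt ℝ ∞ G x := by
        refine ContDiffAt.interpolate (hJ₀.comp x (hsm x hx)).contDiffAt ?_ hs.contDiffAt ?_
        · refine ContDiffAt.pushforward ?_ contDiffAt_const ?_
          · exact (contDiffAt_extChartAt_comp (hsm x hx) hsrc).fderiv_right (by simp)
          · rw [fderiv_extChartAt_comp (hsm x hx) hsrc]
            exact (isInvertible_chartDeriv hsrc).comp (hD x hx)
        · rw [fderiv_extChartAt_comp (hsm x hx) hsrc,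
            pushforward_comp (isInvertible_chartDeriv hsrc),
            ← pushforward_intertwiner (isInvertible_chartDeriv hsrc)]
          exact isInvertible_pushforward (isInvertible_chartDeriv hsrc)
            ((h₀.isLinearCompatible (φ x)).isInvertible_intertwiner (hJφ x hx) (hσ (φ x)) (hs0 x))
      have hGX : ContMDiffAt I 𝓘(ℝ, E →L[ℝ] E) ∞ (G ∘ X) (φ x) := by
        refine ContMDiffAt.comp (φ x) ?_ hXs
        rw [hX x hx]
        exact hGs.contMDiffAt
      refine hGX.congr_of_eventuallyEq ?_
      filter_upwards [hXU, (chartAt H (φ x)).open_source.mem_nhds hsrc]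
      rintro _ ⟨y, hy, rfl⟩ hys
      rw [Function.comp_apply, hX y hy, hG y hy hys, hJU y hy]
    · refine (J₀.contMDiff p).congr_of_eventuallyEq ?_
      filter_upwards [hclosed.isOpen_compl.mem_nhds hp] with q hq
      exact congrArg _ (hJout q hq)
  · have hxU : x ∈ U := hρU (Metric.closedBall_subset_closedBall hrρ.le hx)
    have hJx : J (φ x) = pushforward (vectorDeriv I φ x) (JSt n) := by
      rw [hJU x hxU]
      simp only [K, hsr x hx, interpolate_zero]
    change J (φ x) (vectorDeriv I φ x v) = vectorDeriv I φ x (JSt n v)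
    rw [hJx, pushforward_map (hD x hxU)]

end Manifolds

/-! ### Tangent spaces read in their own charts; products -/

section Manifolds

variable {E : Type*} [NormedAddCommGroup E] [NormedSpace ℝ E]
  {E' : Type*} [NormedAddCommGroup E'] [NormedSpace ℝ E']

theorem pushforward_eq_self {D J : E →L[ℝ] E} (hD : D.IsInvertible)
    (h : ∀ v, D (J v) = J (D v)) : pushforward D J = J := by
  ext v
  obtain ⟨w, rfl⟩ := hD.bijective.2 v
  rw [pushforward_map hD, h]

variable {M : Type*} [TopologicalSpace M] [ChartedSpace E M]
  {M' : Type*} [TopologicalSpace M'] [ChartedSpace E' M']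

/-- The tangent space at `q` is identified with `E` through the preferred chart at `q`, so the
derivative of another chart is that of a transition map. -/
theorem chartDeriv_eq_fderiv [IsManifold 𝓘(ℝ, E) ∞ M] {p q : M}
    (hq : q ∈ (chartAt E p).source) :
    chartDeriv 𝓘(ℝ, E) p q =
      fderiv ℝ (fun z => chartAt E p ((chartAt E q).symm z)) (chartAt E q q) := by
  have hd : MDifferentiableAt 𝓘(ℝ, E) 𝓘(ℝ, E) (extChartAt 𝓘(ℝ, E) p) q :=
    (contMDiffAt_extChartAt' (n := ∞) hq).mdifferentiableAt (by simp)
  rw [chartDeriv, hd.mfderiv]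
  change fderivWithin ℝ (fun z => chartAt E p ((chartAt E q).symm z)) (Set.range id)
    (chartAt E q q) = _
  rw [Set.range_id, fderivWithin_univ]

theorem chartDeriv_self [IsManifold 𝓘(ℝ, E) ∞ M] (p : M) :
    chartDeriv 𝓘(ℝ, E) p p = ContinuousLinearMap.id ℝ E := by
  have : IsManifold 𝓘(ℝ, E) 1 M := IsManifold.of_le (n := ∞) (by simp)
  exact mfderiv_extChartAt_self

theorem chartDeriv_prod [IsManifold 𝓘(ℝ, E) ∞ M] [IsManifold 𝓘(ℝ, E') ∞ M'] {p q : M × M'}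
    (h₁ : q.1 ∈ (chartAt E p.1).source) (h₂ : q.2 ∈ (chartAt E' p.2).source) :
    chartDeriv (𝓘(ℝ, E).prod 𝓘(ℝ, E')) p q =
      (chartDeriv 𝓘(ℝ, E) p.1 q.1).prodMap (chartDeriv 𝓘(ℝ, E') p.2 q.2) := by
  have h1 : MDifferentiableAt 𝓘(ℝ, E) 𝓘(ℝ, E) (extChartAt 𝓘(ℝ, E) p.1) q.1 :=
    (contMDiffAt_extChartAt' (n := ∞) h₁).mdifferentiableAt (by simp)
  have h2 : MDifferentiableAt 𝓘(ℝ, E') 𝓘(ℝ, E') (extChartAt 𝓘(ℝ, E') p.2) q.2 :=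
    (contMDiffAt_extChartAt' (n := ∞) h₂).mdifferentiableAt (by simp)
  rw [chartDeriv, modelWithCornersSelf_prod, ← chartedSpaceSelf_prod]
  exact mfderiv_prodMap (p := q) h1 h2

theorem pullback_chartAt_self [IsManifold 𝓘(ℝ, E) ∞ M] (τ : E →L[ℝ] E →L[ℝ] ℝ) (p : M)
    (u v : E) :
    FormField.pullback 𝓘(ℝ, E) 𝓘(ℝ, E) (chartAt E p) (fun _ => τ) p u v = τ u v := by
  have h : mfderiv 𝓘(ℝ, E) 𝓘(ℝ, E) (chartAt E p) p = ContinuousLinearMap.id ℝ E :=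
    chartDeriv_self (E := E) p
  change τ (mfderiv 𝓘(ℝ, E) 𝓘(ℝ, E) (chartAt E p) p u)
    (mfderiv 𝓘(ℝ, E) 𝓘(ℝ, E) (chartAt E p) p v) = _
  rw [h]
  rfl

theorem FormField.prod_apply (σ : FormField 𝓘(ℝ, E) M) (σ' : FormField 𝓘(ℝ, E') M') (p : M × M')
    (u v : E × E') :
    FormField.prod σ σ' p u v = σ p.1 u.1 v.1 + σ' p.2 u.2 v.2 := by
  have h (w : E × E') : mfderiv (𝓘(ℝ, E).prod 𝓘(ℝ, E')) 𝓘(ℝ, E) Prod.fst p w = w.1 := by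
    rw [mfderiv_fst]
    rfl
  have h' (w : E × E') : mfderiv (𝓘(ℝ, E).prod 𝓘(ℝ, E')) 𝓘(ℝ, E') Prod.snd p w = w.2 := by
    rw [mfderiv_snd]
    rfl
  exact congrArg₂ (· + ·) (congrArg₂ (fun x y => σ p.1 x y) (h u) (h v))
    (congrArg₂ (fun x y => σ' p.2 x y) (h' u) (h' v))

end Manifolds

/-! ### The projective line: holomorphic transitions and Hausdorffness -/

namespace CP1

theorem omega_apply (a : ℝ) (p : CP1) (u v : ℂ) :
    omega a p u v = a ^ 2 / (1 + ‖chartAt ℂ p p‖ ^ 2) ^ 2 * (u.re * v.im - u.im * v.re) := by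
  change a ^ 2 / (1 + ‖chartAt ℂ p p‖ ^ 2) ^ 2 *
    FormField.pullback 𝓘(ℝ, ℂ) 𝓘(ℝ, ℂ) (chartAt ℂ p) (fun _ => areaForm) p u v = _
  rw [pullback_chartAt_self]
  simp [areaForm]

theorem differentiableAt_coord_point {i j : Fin 2} {z : ℂ} (h : point j z ∈ domain i) :
    DifferentiableAt ℂ (fun z => coord i (point j z)) z := by
  rcases eq_or_one_sub i j with rfl | rfl
  · have : (fun z => coord j (point j z)) = id := by
      funext z
      exact (chart j).right_inv (Set.mem_univ z)
    rw [this]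
    exact differentiableAt_id
  · have hz : z ≠ 0 := by
      rw [point, mk_mem_domain] at h
      simpa [(one_sub_ne i).symm] using h
    have : (fun z => coord i (point (1 - i) z)) = fun z => z⁻¹ := by
      funext z
      rw [point, coord_mk]
      simp [(one_sub_ne i).symm]
    rw [this]
    exact differentiableAt_inv hz

/-- The transition maps are the identity or `z ↦ z⁻¹`. They are holomorphic, so their real
derivatives are complex linear. -/
theorem chartDeriv_I_mul {p q : CP1} (hq : q ∈ (chartAt ℂ p).source) (v : ℂ) :
    chartDeriv 𝓘(ℝ, ℂ) p q (Complex.I * v) = Complex.I * chartDeriv 𝓘(ℝ, ℂ) p q v := by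
  have hs : point (exists_mem_domain q).choose (chartAt ℂ q q) = q :=
    (chartAt ℂ q).left_inv (mem_chart_source ℂ q)
  have hd : DifferentiableAt ℂ (fun z => chartAt ℂ p ((chartAt ℂ q).symm z)) (chartAt ℂ q q) := by
    refine differentiableAt_coord_point (i := (exists_mem_domain p).choose)
      (j := (exists_mem_domain q).choose) ?_
    rw [hs]
    exact hq
  rw [chartDeriv_eq_fderiv hq, hd.fderiv_restrictScalars ℝ]
  simp only [ContinuousLinearMap.coe_restrictScalars']
  rw [← smul_eq_mul, map_smul, smul_eq_mul]

/-- The orthogonal projection of `ℂ²` onto a complex line, as a matrix. -/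
def projector : CP1 → Fin 2 → Fin 2 → ℂ :=
  Projectivization.lift
    (fun v i j => v.1 i * star (v.1 j) / (v.1 0 * star (v.1 0) + v.1 1 * star (v.1 1))) (by
    rintro v w t h
    have ht : t ≠ 0 := by
      rintro rfl
      exact v.2 (by simpa using h)
    funext i j
    have hts : star t ≠ 0 := star_ne_zero.2 ht
    simp only [h, Pi.smul_apply, smul_eq_mul, star_mul']
    rw [← mul_div_mul_left (w.1 i * star (w.1 j)) _ (mul_ne_zero ht hts)]
    congr 1 <;> ring)

theorem mul_star_add_mul_star_ne_zero {v : Fin 2 → ℂ} (hv : v ≠ 0) :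
    v 0 * star (v 0) + v 1 * star (v 1) ≠ 0 := by
  intro h
  have h' : Complex.normSq (v 0) + Complex.normSq (v 1) = 0 := by
    simp only [Complex.star_def, Complex.mul_conj] at h
    exact_mod_cast h
  have h0 := Complex.normSq_nonneg (v 0)
  have h1 := Complex.normSq_nonneg (v 1)
  refine hv (funext fun i => ?_)
  fin_cases i
  · exact Complex.normSq_eq_zero.1 (show Complex.normSq (v 0) = 0 by linarith)
  · exact Complex.normSq_eq_zero.1 (show Complex.normSq (v 1) = 0 by linarith)

theorem continuous_projector : Continuous projector := by
  rw [isQuotientMap_mk.continuous_iff]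
  have h0 (j : Fin 2) : Continuous fun v : {v : Fin 2 → ℂ // v ≠ 0} => v.1 j :=
    (continuous_apply j).comp continuous_subtype_val
  refine continuous_pi fun i => continuous_pi fun j => ?_
  exact ((h0 i).mul (h0 j).star).div (((h0 0).mul (h0 0).star).add ((h0 1).mul (h0 1).star))
    fun v => mul_star_add_mul_star_ne_zero v.2

/-- A nonzero column of the projection matrix spans the line. The scalar below compares the `j`-th
columns for an index with `v j ≠ 0`. -/
theorem projector_injective : Function.Injective projector := by
  intro p q h
  obtain ⟨v, rfl⟩ := mk_surjective p
  obtain ⟨w, rfl⟩ := mk_surjective q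
  obtain ⟨j, hj⟩ : ∃ j, v.1 j ≠ 0 := by
    by_contra! h'
    exact v.2 (funext h')
  have hc := mul_star_add_mul_star_ne_zero v.2
  have hd := mul_star_add_mul_star_ne_zero w.2
  set c := v.1 0 * star (v.1 0) + v.1 1 * star (v.1 1)
  set d := w.1 0 * star (w.1 0) + w.1 1 * star (w.1 1)
  have hs : star (v.1 j) ≠ 0 := star_ne_zero.2 hj
  refine (Projectivization.mk_eq_mk_iff' ℂ _ _ _ _).2
    ⟨c * star (w.1 j) / (d * star (v.1 j)), funext fun i => ?_⟩
  have hij : v.1 i * star (v.1 j) / c = w.1 i * star (w.1 j) / d :=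
    congrFun (congrFun h i) j
  rw [div_eq_div_iff hc hd] at hij
  rw [Pi.smul_apply, smul_eq_mul, div_mul_eq_mul_div, div_eq_iff (mul_ne_zero hd hs)]
  linear_combination -hij

instance : T2Space CP1 := T2Space.of_injective_continuous projector_injective continuous_projector

end CP1

/-! ### The torus: transitions by translations and Hausdorffness -/

namespace Torus

variable {m : ℕ} {N : ℝ}

instance : T2Space (Torus m N) := by
  have : DiscreteTopology (lattice m N) := isDiscrete_lattice.1
  have : IsClosed (lattice m N : Set (R2 m)) := AddSubgroup.isClosed_of_discrete
  exact inferInstanceAs (T2Space (R2 m ⧸ lattice m N))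

/-- The transition maps between the charts of the torus are locally translations. -/
theorem eventually_chart_chart_eq_add (a b : R2 m) {x : R2 m}
    (hx : x ∈ ((chart (N := N) a).symm ≫ₕ chart b).source) :
    ∃ c : R2 m, (fun y => chart (N := N) b ((chart a).symm y))
      =ᶠ[𝓝[((chart (N := N) a).symm ≫ₕ chart b).source] x] fun y => y + c := by
  set S := ((chart (N := N) a).symm ≫ₕ chart b).source with hS
  set f : R2 m → R2 m := fun x => chart (N := N) b ((chart a).symm x) with hf
  have key : ∀ x ∈ S, f x - x ∈ lattice m N := by
    intro x hx
    have hx2 : (chart a).symm x ∈ (chart (N := N) b).source := hx.2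
    rw [← proj_eq_proj, hf, proj_chart b hx2, chart_symm]
  have hc : ContinuousOn (fun x => f x - x) S :=
    ((chart (N := N) a).symm ≫ₕ chart b).continuousOn.sub continuousOn_id
  obtain ⟨r, hr, h0⟩ := exists_lattice_radius m N
  refine ⟨f x - x, ?_⟩
  -- The displacement `f y - y` is continuous with values in the lattice, and two lattice vectors
  -- closer than `r` coincide; so it is locally constant.
  filter_upwards [hc x hx (Metric.ball_mem_nhds _ hr), self_mem_nhdsWithin] with y hy hys
  have h1 := h0 _ (sub_mem (key y hys) (key x hx)) (mem_ball_iff_norm.1 hy)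
  rw [sub_eq_zero] at h1
  rw [← h1]
  abel

theorem omega_apply (q : Torus m N) (u v : R2 m) : omega m N q u v = omegaSt m u v :=
  pullback_chartAt_self (omegaSt m) q u v

theorem chartDeriv_eq_id {p q : Torus m N} (hq : q ∈ (chartAt (R2 m) p).source) :
    chartDeriv 𝓘(ℝ, R2 m) p q = ContinuousLinearMap.id ℝ (R2 m) := by
  rw [chartDeriv_eq_fderiv hq]
  set a := chartAt (R2 m) q q
  set S := ((chartAt (R2 m) q).symm ≫ₕ chartAt (R2 m) p).source with hS
  have haS : a ∈ S := by
    refine ⟨(chartAt (R2 m) q).map_source (mem_chart_source _ q), ?_⟩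
    change (chartAt (R2 m) q).symm (chartAt (R2 m) q q) ∈ (chartAt (R2 m) p).source
    rwa [(chartAt (R2 m) q).left_inv (mem_chart_source _ q)]
  have hSo : IsOpen S := ((chartAt (R2 m) q).symm ≫ₕ chartAt (R2 m) p).open_source
  obtain ⟨c, hc⟩ : ∃ c : R2 m, (fun z => chartAt (R2 m) p ((chartAt (R2 m) q).symm z)) =ᶠ[𝓝 a]
      fun z => z + c := by
    rw [← hSo.nhdsWithin_eq haS]
    exact eventually_chart_chart_eq_add (lift q) (lift p) haS
  rw [hc.fderiv_eq, fderiv_add_const]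
  exact fderiv_fun_id

end Torus

/-! ### The product structure and the conclusion -/

theorem omegaProd_apply (a : ℝ) (m : ℕ) (N : ℝ) (p : CP1 × Torus m N) (u v : ℂ × R2 m) :
    omegaProd a m N p u v =
      a ^ 2 / (1 + ‖chartAt ℂ p.1 p.1‖ ^ 2) ^ 2 * (u.1.re * v.1.im - u.1.im * v.1.re) +
        omegaSt m u.2 v.2 := by
  rw [omegaProd, FormField.prod_apply, CP1.omega_apply, Torus.omega_apply]

theorem omegaProd_antisymm (a : ℝ) (m : ℕ) (N : ℝ) (p : CP1 × Torus m N) (u v : ℂ × R2 m) :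
    omegaProd a m N p u v = -omegaProd a m N p v u := by
  rw [omegaProd_apply, omegaProd_apply, omegaSt_antisymm]
  ring

/-- The standard complex structure on `ℂ × ℝ²ᵐ`. -/
def JProd (m : ℕ) : ℂ × R2 m →L[ℝ] ℂ × R2 m :=
  ((ContinuousLinearMap.mul ℝ ℂ) Complex.I).prodMap (JSt m)

theorem JProd_apply (m : ℕ) (v : ℂ × R2 m) : JProd m v = (Complex.I * v.1, JSt m v.2) := rfl

theorem isLinearCompatible_JProd {a : ℝ} (ha : 0 < a) (m : ℕ) (N : ℝ) (p : CP1 × Torus m N) :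
    IsLinearCompatible (E := ℂ × R2 m) (omegaProd a m N p) (JProd m) where
  sq v := by
    rw [JProd_apply, JProd_apply, (isLinearCompatible_JSt m).sq, ← mul_assoc]
    simp
    rfl
  symm u v := by
    refine (omegaProd_apply a m N p u (JProd m v)).trans
      (Eq.trans ?_ (omegaProd_apply a m N p v (JProd m u)).symm)
    rw [JProd_apply, JProd_apply, (isLinearCompatible_JSt m).symm]
    simp only [Complex.mul_re, Complex.mul_im, Complex.I_re, Complex.I_im]
    ring
  pos v hv := by
    refine lt_of_lt_of_eq ?_ (omegaProd_apply a m N p v (JProd m v)).symm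
    rw [JProd_apply]
    have hc : 0 < a ^ 2 / (1 + ‖chartAt ℂ p.1 p.1‖ ^ 2) ^ 2 := by positivity
    have h1 : v.1.re * (Complex.I * v.1).im - v.1.im * (Complex.I * v.1).re =
        Complex.normSq v.1 := by
      simp [Complex.normSq_apply]
    rw [h1]
    by_cases h : v.2 = 0
    · have hv1 : v.1 ≠ 0 := fun h' => hv (Prod.ext h' h)
      rw [h]
      simpa using mul_pos hc (Complex.normSq_pos.2 hv1)
    · have h2 := (isLinearCompatible_JSt m).pos _ h
      have h3 := Complex.normSq_nonneg v.1
      positivity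

/-- The product complex structure on `ℂP¹ × T`. -/
def productComplexStructure (m : ℕ) (N : ℝ) :
    AlmostComplexStructure (𝓘(ℝ, ℂ).prod 𝓘(ℝ, R2 m)) (CP1 × Torus m N) where
  toFun _ := JProd m
  contMDiff p := by
    refine contMDiffAt_endomorphism_iff.2 ?_
    refine (contMDiffAt_const (c := JProd m)).congr_of_eventuallyEq ?_
    filter_upwards [(chartAt (ModelProd ℂ (R2 m)) p).open_source.mem_nhds (mem_chart_source _ p)]
      with q hq
    -- A field that is constant in each point's own chart is constant in a fixed chart once the
    -- transition derivatives commute with it: they are complex linear on the first factor and the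
    -- identity on the second.
    refine pushforward_eq_self (isInvertible_chartDeriv hq) fun v => ?_
    rw [prodChartedSpace_chartAt, OpenPartialHomeomorph.prod_source] at hq
    rw [chartDeriv_prod hq.1 hq.2, Torus.chartDeriv_eq_id hq.2, JProd_apply, JProd_apply]
    exact Prod.ext (CP1.chartDeriv_I_mul hq.1 v.1) rfl
  -- The identity `J² = -1` does not involve the area, so the value 1 stands in for `a`.
  sq_eq_neg p v := (isLinearCompatible_JProd one_pos m N p).sq v

end

theorem lemma2p1 (n : ℕ) (hn : 2 ≤ n) (a N : ℝ) (ha : 0 < a) (hN : 0 < N)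
    (R R' : ℝ) (hR' : 0 < R') (hR : R' < R)
    (φ : R2 n → CP1 × Torus (n - 1) N)
    (hφ : IsSymplecticEmbeddingOn (𝓘(ℝ, ℂ).prod 𝓘(ℝ, R2 (n - 1))) φ
      (Metric.closedBall 0 R) (omegaProd a (n - 1) N)) :
    ∃ J : AlmostComplexStructure (𝓘(ℝ, ℂ).prod 𝓘(ℝ, R2 (n - 1))) (CP1 × Torus (n - 1) N),
      J.IsCompatible (omegaProd a (n - 1) N) ∧
        ∀ x ∈ Metric.closedBall (0 : R2 n) R', ∀ v : R2 n,
          J.toFun (φ x) (mfderiv 𝓘(ℝ, R2 n) (𝓘(ℝ, ℂ).prod 𝓘(ℝ, R2 (n - 1))) φ x v) =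
            mfderiv 𝓘(ℝ, R2 n) (𝓘(ℝ, ℂ).prod 𝓘(ℝ, R2 (n - 1))) φ x (JSt n v) := by
  have hJ : (productComplexStructure (n - 1) N).IsCompatible (omegaProd a (n - 1) N) :=
    ⟨fun p => (isLinearCompatible_JProd ha (n - 1) N p).symm,
      fun p => (isLinearCompatible_JProd ha (n - 1) N p).pos⟩
  refine exists_isCompatible_extending_JSt (omegaProd_antisymm a (n - 1) N) hJ ?_ hR' hR hφ
  -- The dimension count `2n = 2 + 2(n - 1)` needs `n ≥ 1`, the subtraction being truncated.
  rw [Module.finrank_prod, Complex.finrank_real_complex, finrank_euclideanSpace,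
    finrank_euclideanSpace]
  simp only [Fintype.card_prod, Fintype.card_fin]
  omega
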